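/- Let $\mathcal H$ be a complex Hilbert space and let $K$ be a bounded, boundedly invertible operator on $\mathcal H$. A densely defined closable operator $T$ in $\mathcal H$ is called $K$-invariant if $K^*TK=T$, that is, $\mathcal D(T)=\{f\in\mathcal H : Kf\in\mathcal D(T)\}$ and $K^*TKf=Tf$ for all $f\in\mathcal D(T)$. Let $S$ be a densely defined, closed, symmetric operator in $\mathcal H$ that is strictly positive, i.e. $\langle f,Sf\rangle\ge\varepsilon\|f\|^2$ for all $f\in\mathcal D(S)$ and some $\varepsilon>0$, and suppose that $S$ is $K$-invariant. Let $S_F$ be the Friedrichs extension of $S$, i.e. the restriction of $S^*$ to the set of all $f\in\mathcal D(S^*)$ for which there is a sequence $(f_n)$ in $\mathcal D(S)$ with $f_n\to f$ and $\langle f_n-f_m,S(f_n-f_m)\rangle\to0$ as $n,m\to\infty$. Let $\mathfrak M$ be a closed subspace of $\ker(S^*)$ with $K^{-1}\mathfrak M=\mathfrak M$. Then $S_F$ is a bijection of $\mathcal D(S_F)$ onto $\mathcal H$, the three subspaces $\mathcal D(S)$, $\mathfrak M$ and $\{S_F^{-1}\eta : \eta\in\mathfrak M^\perp\cap\ker(S^*)\}$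 are linearly independent and contained in $\mathcal D(S^*)$, and the operator $$S_{\mathfrak M}=S^*\upharpoonright_{\mathcal D(S_{\mathfrak M})},\qquad \mathcal D(S_{\mathfrak M})=\mathcal D(S)\dot+\mathfrak M\dot+\{S_F^{-1}\eta : \eta\in\mathfrak M^\perp\cap\ker(S^*)\},$$ is an extension of $S$ which is densely defined, closable and $K$-invariant. -/

import Mathlib

open scoped InnerProductSpace LinearPMap Topology
open Filter

namespace KInvariant

variable {H : Type*} [NormedAddCommGroup H] [InnerProductSpace ℂ H]

/-- `S` is a (densely defined) nonnegative symmetric operator in `H`. -/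
structure IsNonnegSymmetric (S : H →ₗ.[ℂ] H) : Prop where
  dense : Dense (S.domain : Set H)
  symm : ∀ f g : S.domain, ⟪S f, (g : H)⟫_ℂ = ⟪(f : H), S g⟫_ℂ
  nonneg : ∀ f : S.domain, 0 ≤ (⟪(f : H), S f⟫_ℂ).re

/-- `S` is a (densely defined) strictly positive symmetric operator in `H`: `S ≥ ε I` for
some `ε > 0`. -/
structure IsStrictlyPosSymmetric (S : H →ₗ.[ℂ] H) : Prop where
  dense : Dense (S.domain : Set H)
  symm : ∀ f g : S.domain, ⟪S f, (g : H)⟫_ℂ = ⟪(f : H), S g⟫_ℂ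
  pos : ∃ ε : ℝ, 0 < ε ∧ ∀ f : S.domain, ε * ‖(f : H)‖ ^ 2 ≤ (⟪(f : H), S f⟫_ℂ).re

theorem IsStrictlyPosSymmetric.isNonnegSymmetric {S : H →ₗ.[ℂ] H}
    (hS : IsStrictlyPosSymmetric S) : IsNonnegSymmetric S where
  dense := hS.dense
  symm := hS.symm
  nonneg f := by
    obtain ⟨ε, hε, h⟩ := hS.pos
    exact le_trans (by positivity) (h f)

/-- `g` is the limit in `H` of a sequence `f_n` in `D(S)` with
`⟨f_n - f_m, S (f_n - f_m)⟩ → 0` as `n, m → ∞`. -/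
def InFormDomain (S : H →ₗ.[ℂ] H) (g : H) : Prop :=
  ∃ f : ℕ → S.domain, Tendsto (fun n => (f n : H)) atTop (𝓝 g) ∧
    Tendsto (fun p : ℕ × ℕ => ⟪((f p.1 - f p.2 : S.domain) : H), S (f p.1 - f p.2)⟫_ℂ)
      atTop (𝓝 0)

theorem IsNonnegSymmetric.inner_eq_re {S : H →ₗ.[ℂ] H} (hS : IsNonnegSymmetric S)
    (f : S.domain) : ⟪(f : H), S f⟫_ℂ = ((⟪(f : H), S f⟫_ℂ).re : ℂ) := by
  have h : (starRingEnd ℂ) ⟪(f : H), S f⟫_ℂ = ⟪(f : H), S f⟫_ℂ := by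
    rw [inner_conj_symm, hS.symm]
  exact (Complex.conj_eq_iff_re.mp h).symm

theorem IsNonnegSymmetric.norm_inner_add_le {S : H →ₗ.[ℂ] H} (hS : IsNonnegSymmetric S)
    (f g : S.domain) :
    ‖⟪((f + g : S.domain) : H), S (f + g)⟫_ℂ‖ ≤
      2 * ‖⟪(f : H), S f⟫_ℂ‖ + 2 * ‖⟪(g : H), S g⟫_ℂ‖ := by
  have key : ∀ h : S.domain, ‖⟪(h : H), S h⟫_ℂ‖ = (⟪(h : H), S h⟫_ℂ).re := fun h => by
    rw [hS.inner_eq_re h, Complex.norm_real, Complex.ofReal_re, Real.norm_of_nonneg (hS.nonneg h)]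
  rw [key, key, key]
  have h1 := hS.nonneg (f - g)
  simp only [LinearPMap.map_sub, LinearPMap.map_add, Submodule.coe_sub, Submodule.coe_add,
    inner_add_left, inner_add_right, inner_sub_left, inner_sub_right, Complex.add_re,
    Complex.sub_re] at h1 ⊢
  linarith

/-- The domain of the Friedrichs extension. -/
def friedrichsDomain (S : H →ₗ.[ℂ] H) (hS : IsNonnegSymmetric S) [CompleteSpace H] :
    Submodule ℂ H where
  carrier := {g | g ∈ (S†).domain ∧ InFormDomain S g}
  zero_mem' := ⟨Submodule.zero_mem _, fun _ => 0, by simp, by simp⟩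
  add_mem' := by
    rintro a b ⟨ha, f, hf, hf'⟩ ⟨hb, g, hg, hg'⟩
    refine ⟨Submodule.add_mem _ ha hb, fun n => f n + g n, by simpa using hf.add hg, ?_⟩
    have h := (hf'.norm.const_mul 2).add (hg'.norm.const_mul 2)
    simp only [norm_zero, mul_zero, add_zero] at h
    refine squeeze_zero_norm (fun p => ?_) h
    rw [add_sub_add_comm]
    exact hS.norm_inner_add_le _ _
  smul_mem' := by
    rintro c a ⟨ha, f, hf, hf'⟩
    refine ⟨Submodule.smul_mem _ c ha, fun n => c • f n, by simpa using hf.const_smul c, ?_⟩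
    have h := (hf'.const_mul c).const_mul ((starRingEnd ℂ) c)
    simp only [mul_zero] at h
    refine h.congr fun p => ?_
    rw [← smul_sub, LinearPMap.map_smul, Submodule.coe_smul, inner_smul_left, inner_smul_right]

variable [CompleteSpace H]

/-- The Friedrichs extension `S_F` of a nonnegative symmetric operator `S`: the restriction of
`S*` to the vectors of `D(S*)` that lie in the domain of the closure of the form of `S`. -/
noncomputable def friedrichs (S : H →ₗ.[ℂ] H) (hS : IsNonnegSymmetric S) : H →ₗ.[ℂ] H where
  domain := friedrichsDomain S hS
  toFun := (S†).toFun ∘ₗ Submodule.inclusion fun _ h => h.1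

/-- The subspace `ker S*` of `H`. -/
noncomputable def kerAdjoint (S : H →ₗ.[ℂ] H) : Submodule ℂ H :=
  (LinearMap.ker (S†).toFun).map (S†).domain.subtype

/-- The subspace `{T⁻¹ η | η ∈ N}` of `H`, with `η` in the domain of `T⁻¹`. -/
noncomputable def inverseImage (T : H →ₗ.[ℂ] H) (N : Submodule ℂ H) : Submodule ℂ H :=
  (N.comap T.inverse.domain.subtype).map T.inverse.toFun

/-- The operator `K* T K`, with domain `{f | K f ∈ D(T)}`. -/
noncomputable def conjugate (K : H ≃L[ℂ] H) (T : H →ₗ.[ℂ] H) : H →ₗ.[ℂ] H where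
  domain := T.domain.comap (K : H →ₗ[ℂ] H)
  toFun := (ContinuousLinearMap.adjoint (K : H →L[ℂ] H) : H →ₗ[ℂ] H) ∘ₗ T.toFun ∘ₗ
    (K : H →ₗ[ℂ] H).restrict fun _ h => h

/-- A densely defined, closable operator `T` is `K`-invariant if `K* T K = T`, as an equality of
unbounded operators (equal domains and equal values). -/
structure IsKInvariant (K : H ≃L[ℂ] H) (T : H →ₗ.[ℂ] H) : Prop where
  dense : Dense (T.domain : Set H)
  closable : T.IsClosable
  conjugate_eq : conjugate K T = T

/-- The third summand `{S_F⁻¹ η | η ∈ M^⊥ ∩ ker S*}` in the domain of `S_M`. -/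
noncomputable def friedrichsPart (S : H →ₗ.[ℂ] H) (hS : IsNonnegSymmetric S)
    (M : Submodule ℂ H) : Submodule ℂ H :=
  inverseImage (friedrichs S hS) (Mᗮ ⊓ kerAdjoint S)

/-- The domain `D(S) + M + {S_F⁻¹ η | η ∈ M^⊥ ∩ ker S*}` of `S_M`. -/
noncomputable def extensionDomain (S : H →ₗ.[ℂ] H) (hS : IsNonnegSymmetric S)
    (M : Submodule ℂ H) : Submodule ℂ H :=
  S.domain ⊔ M ⊔ friedrichsPart S hS M

/-- The operator `S_M`: the restriction of `S*` to `D(S) + M + {S_F⁻¹ η | η ∈ M^⊥ ∩ ker S*}`. -/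
noncomputable def extension (S : H →ₗ.[ℂ] H) (hS : IsNonnegSymmetric S)
    (M : Submodule ℂ H) : H →ₗ.[ℂ] H :=
  (S†).domRestrict (extensionDomain S hS M)

end KInvariant

/-! Strict positivity makes `S_F` bijective. It is injective because a form-domain vector orthogonal
to `ran S` vanishes (`eq_zero_of_inFormDomain`). It is onto because minimising `⟨f, S f⟩ - 2 re ⟨h,
f⟩` over `D(S)` solves `S_F g = h` (`exists_inFormDomain_forall_inner_eq`).

For invariance, `K` preserves the form of `S`, so `S*` and `S_F` inherit `K* T K = T`, and hence `K
S_F⁻¹ η = S_F⁻¹ (K⁻¹)* η`. The map `(K⁻¹)*` preserves `Mᗮ`, since `K⁻¹ M = M`, but need not preserve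
`Mᗮ ∩ ker S*`. The summands are therefore regrouped: `ran S` is closed, so `H = ran S ⊕ ker S*`; as
`ran S ⊆ Mᗮ` and `S ⊆ S_F`, the domain of `S_M` is `M + S_F⁻¹ Mᗮ` (`mem_extensionDomain_iff`), which
`K` visibly preserves. -/

namespace KInvariant

variable {H : Type*} [NormedAddCommGroup H] [InnerProductSpace ℂ H]

/-- The quadratic form `re ⟪f, S f⟫` of an operator. -/
noncomputable def quadForm (S : H →ₗ.[ℂ] H) (f : S.domain) : ℝ := (⟪(f : H), S f⟫_ℂ).re

theorem mem_graph_iff_exists_mem {f : H →ₗ.[ℂ] H} {x y : H} :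
    (x, y) ∈ f.graph ↔ ∃ hx : x ∈ f.domain, f ⟨x, hx⟩ = y := by
  simp [LinearPMap.mem_graph_iff]

/-! ### Algebra of the quadratic form. -/

section Symmetric

variable {S : H →ₗ.[ℂ] H}

theorem quadForm_add (hsymm : ∀ f g : S.domain, ⟪S f, (g : H)⟫_ℂ = ⟪(f : H), S g⟫_ℂ)
    (f g : S.domain) :
    quadForm S (f + g) = quadForm S f + quadForm S g + 2 * (⟪(f : H), S g⟫_ℂ).re := by
  have h : (⟪(g : H), S f⟫_ℂ).re = (⟪(f : H), S g⟫_ℂ).re := by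
    rw [← hsymm f g, ← inner_conj_symm, Complex.conj_re]
  simp only [quadForm, LinearPMap.map_add, Submodule.coe_add, inner_add_left, inner_add_right,
    Complex.add_re, h]
  ring

theorem quadForm_smul (c : ℝ) (f : S.domain) :
    quadForm S ((c : ℂ) • f) = c ^ 2 * quadForm S f := by
  simp only [quadForm, LinearPMap.map_smul, Submodule.coe_smul, inner_smul_left, inner_smul_right,
    Complex.conj_ofReal, Complex.re_ofReal_mul]
  ring

theorem quadForm_neg (f : S.domain) : quadForm S (-f) = quadForm S f := by
  simp [quadForm, LinearPMap.map_neg]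

theorem quadForm_sub (hsymm : ∀ f g : S.domain, ⟪S f, (g : H)⟫_ℂ = ⟪(f : H), S g⟫_ℂ)
    (f g : S.domain) :
    quadForm S (f - g) = quadForm S f + quadForm S g - 2 * (⟪(f : H), S g⟫_ℂ).re := by
  rw [sub_eq_add_neg, quadForm_add hsymm, quadForm_neg, LinearPMap.map_neg, inner_neg_right,
    Complex.neg_re]
  ring

end Symmetric

/-! ### Closed range, and the equation `S* g = h` in the form domain. -/

namespace IsStrictlyPosSymmetric

variable {S : H →ₗ.[ℂ] H}

theorem mul_norm_le (hS : IsStrictlyPosSymmetric S) :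
    ∃ ε : ℝ, 0 < ε ∧ ∀ f : S.domain, ε * ‖(f : H)‖ ≤ ‖S f‖ := by
  obtain ⟨ε, hε, h⟩ := hS.pos
  refine ⟨ε, hε, fun f => ?_⟩
  have h1 : ε * ‖(f : H)‖ ^ 2 ≤ ‖(f : H)‖ * ‖S f‖ :=
    (h f).trans ((Complex.re_le_norm _).trans (norm_inner_le_norm _ _))
  rcases (norm_nonneg (f : H)).eq_or_lt with h0 | h0
  · simp [← h0]
  · refine le_of_mul_le_mul_left ?_ h0
    linarith [h1, sq ‖(f : H)‖, mul_left_comm ε ‖(f : H)‖ ‖(f : H)‖]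

/-- The bound `ε ‖f‖ ≤ ‖S f‖` makes preimages of a convergent sequence Cauchy; the closed graph does
the rest. -/
theorem isClosed_range [CompleteSpace H] (hS : IsStrictlyPosSymmetric S) (hc : S.IsClosed) :
    IsClosed (LinearMap.range S.toFun : Set H) := by
  obtain ⟨ε, hε, hb⟩ := hS.mul_norm_le
  refine isClosed_of_closure_subset fun v hv => ?_
  obtain ⟨u, hu, huv⟩ := mem_closure_iff_seq_limit.1 hv
  choose f hf using hu
  have hcau : CauchySeq fun n => (f n : H) := by
    refine Metric.cauchySeq_iff.2 fun δ hδ => ?_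
    obtain ⟨N, hN⟩ := Metric.cauchySeq_iff.1 huv.cauchySeq (ε * δ) (by positivity)
    refine ⟨N, fun m hm n hn => ?_⟩
    have h1 := hN m hm n hn
    have h2 := hb (f m - f n)
    rw [dist_eq_norm] at h1 ⊢
    have h3 : S (f m - f n) = u m - u n := by
      rw [LinearPMap.map_sub]
      exact congrArg₂ _ (hf m) (hf n)
    rw [h3, Submodule.coe_sub] at h2
    exact lt_of_mul_lt_mul_left (h2.trans_lt h1) hε.le
  obtain ⟨g, hg⟩ := cauchySeq_tendsto_of_complete hcau
  have hmem : (g, v) ∈ S.graph := by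
    refine IsClosed.mem_of_tendsto hc (hg.prodMk_nhds huv) (Eventually.of_forall fun n => ?_)
    have := S.mem_graph (f n)
    rwa [show S (f n) = u n from hf n] at this
  obtain ⟨y, -, hy2⟩ := (LinearPMap.mem_graph_iff S).1 hmem
  exact ⟨y, hy2⟩

/-- A vector of the form domain that annihilates the range of `S` vanishes. -/
theorem eq_zero_of_inFormDomain (hS : IsStrictlyPosSymmetric S) {g : H} (hg : InFormDomain S g)
    (h0 : ∀ x : S.domain, ⟪g, S x⟫_ℂ = 0) : g = 0 := by
  obtain ⟨ε, hε, hpos⟩ := hS.pos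
  obtain ⟨f, hf, hq⟩ := hg
  have hlim : Tendsto (fun n => ε * ‖(f n : H)‖ ^ 2) atTop (𝓝 (ε * ‖g‖ ^ 2)) :=
    (hf.norm.pow 2).const_mul ε
  -- Expand `q(f m - f n) < δ` with `n` fixed and `m → ∞`: the cross term tends to `re ⟨g, S (f n)⟩
  -- = 0` and `q(f m) ≥ 0`, which leaves `ε ‖f n‖² ≤ δ`.
  have key : ∀ δ > 0, ε * ‖g‖ ^ 2 ≤ δ := fun δ hδ => by
    have hq' : Tendsto (fun p : ℕ × ℕ => quadForm S (f p.1 - f p.2)) atTop (𝓝 0) :=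
      (Complex.continuous_re.tendsto _).comp hq
    have hev := hq'.eventually_lt_const hδ
    rw [← prod_atTop_atTop_eq] at hev
    refine le_of_tendsto hlim ?_
    filter_upwards [hev.curry] with n hn
    have h1 : Tendsto (fun m => (⟪(f m : H), S (f n)⟫_ℂ).re) atTop (𝓝 0) := by
      have := (hf.inner (𝕜 := ℂ) (tendsto_const_nhds (x := S (f n))))
      rw [h0] at this
      exact (Complex.continuous_re.tendsto _).comp this
    have h2 : Tendsto (fun m => δ + 2 * (⟪(f m : H), S (f n)⟫_ℂ).re) atTop (𝓝 δ) := by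
      simpa using (h1.const_mul 2).const_add δ
    refine ge_of_tendsto h2 ?_
    filter_upwards [hn] with m hm
    have h3 := quadForm_sub hS.symm (f m) (f n)
    rw [← quadForm_neg, neg_sub] at h3
    have h4 := hpos (f n)
    have h5 := hS.isNonnegSymmetric.nonneg (f m)
    simp only [quadForm] at *
    linarith
  have h1 : ε * ‖g‖ ^ 2 ≤ 0 := le_of_forall_pos_le_add fun δ hδ => by simpa using key δ hδ
  have h2 : ‖g‖ ^ 2 ≤ 0 := by
    by_contra h
    exact absurd h1 (not_le.2 (mul_pos hε (not_le.1 h)))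
  exact norm_eq_zero.1 (pow_eq_zero_iff two_ne_zero |>.1 (le_antisymm h2 (sq_nonneg _)))

/-- The functional whose minimiser solves `S_F g = h`. -/
noncomputable def energy (S : H →ₗ.[ℂ] H) (h : H) (f : S.domain) : ℝ :=
  quadForm S f - 2 * (⟪h, (f : H)⟫_ℂ).re

theorem bddBelow_energy (hS : IsStrictlyPosSymmetric S) (h : H) :
    BddBelow (Set.range (energy S h)) := by
  obtain ⟨ε, hε, hpos⟩ := hS.pos
  -- The minimum over `t` of `ε t² - 2 ‖h‖ t`.
  refine ⟨-(‖h‖ ^ 2 / ε), ?_⟩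
  rintro _ ⟨f, rfl⟩
  have h1 := hpos f
  have h2 : (⟪h, (f : H)⟫_ℂ).re ≤ ‖h‖ * ‖(f : H)‖ :=
    (Complex.re_le_norm _).trans (norm_inner_le_norm _ _)
  have h3 : ε * (‖(f : H)‖ - ‖h‖ / ε) ^ 2 =
      ε * ‖(f : H)‖ ^ 2 - 2 * (‖h‖ * ‖(f : H)‖) + ‖h‖ ^ 2 / ε := by
    field_simp
    ring
  have h4 : 0 ≤ ε * (‖(f : H)‖ - ‖h‖ / ε) ^ 2 := by positivity
  simp only [energy, quadForm]
  linarith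

/-- Parallelogram law; the linear terms cancel. Near-minimisers are thus close in the form, so a
minimising sequence is form-Cauchy. -/
theorem energy_midpoint (hS : IsStrictlyPosSymmetric S) (h : H) (f g : S.domain) :
    quadForm S (f - g) = 2 * energy S h f + 2 * energy S h g -
      4 * energy S h (((1 / 2 : ℝ) : ℂ) • (f + g)) := by
  simp only [energy, quadForm_smul, quadForm_sub hS.symm, quadForm_add hS.symm,
    Submodule.coe_smul, Submodule.coe_add, inner_smul_right, inner_add_right,
    Complex.re_ofReal_mul, Complex.add_re]
  ring

theorem energy_add_smul (hS : IsStrictlyPosSymmetric S) (h : H) (f x : S.domain) (t : ℝ) :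
    energy S h (f + (t : ℂ) • x) = energy S h f +
      2 * t * ((⟪(f : H), S x⟫_ℂ).re - (⟪h, (x : H)⟫_ℂ).re) + t ^ 2 * quadForm S x := by
  simp only [energy, quadForm_smul, quadForm_add hS.symm, LinearPMap.map_smul,
    Submodule.coe_smul, Submodule.coe_add, inner_smul_right, inner_add_right,
    Complex.re_ofReal_mul, Complex.add_re]
  ring

/-- The equation `S* g = h` has a solution in the form domain. -/
theorem exists_inFormDomain_forall_inner_eq [CompleteSpace H] (hS : IsStrictlyPosSymmetric S)
    (h : H) : ∃ g, InFormDomain S g ∧ ∀ x : S.domain, ⟪h, (x : H)⟫_ℂ = ⟪g, S x⟫_ℂ := by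
  obtain ⟨ε, hε, hpos⟩ := hS.pos
  have hbdd := hS.bddBelow_energy h
  obtain ⟨u, -, hu, hur⟩ :=
    exists_seq_tendsto_sInf (Set.range_nonempty (energy S h)) hbdd
  choose f hf using hur
  set d := sInf (Set.range (energy S h)) with hd
  have hd_le : ∀ x, d ≤ energy S h x := fun x => csInf_le hbdd ⟨x, rfl⟩
  have hnn := hS.isNonnegSymmetric.nonneg
  have hE : Tendsto (fun n => energy S h (f n)) atTop (𝓝 d) := by simpa only [hf] using hu
  have hqE : Tendsto (fun p : ℕ × ℕ => quadForm S (f p.1 - f p.2)) atTop (𝓝 0) := by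
    have h1 : Tendsto (fun p : ℕ × ℕ => 2 * energy S h (f p.1) + 2 * energy S h (f p.2) - 4 * d)
        atTop (𝓝 (2 * d + 2 * d - 4 * d)) := by
      rw [← prod_atTop_atTop_eq]
      exact (((hE.comp tendsto_fst).const_mul 2).add ((hE.comp tendsto_snd).const_mul 2)).sub_const _
    rw [show 2 * d + 2 * d - 4 * d = 0 by ring] at h1
    refine squeeze_zero (fun p => hnn _) (fun p => ?_) h1
    rw [hS.energy_midpoint h]
    linarith [hd_le (((1 / 2 : ℝ) : ℂ) • (f p.1 + f p.2))]
  have hcau : CauchySeq fun n => (f n : H) := by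
    refine Metric.cauchySeq_iff'.2 fun δ hδ => ?_
    have hev := hqE.eventually_lt_const (show 0 < ε * δ ^ 2 by positivity)
    obtain ⟨⟨N₁, N₂⟩, hN⟩ := eventually_atTop.1 hev
    refine ⟨max N₁ N₂, fun n hn => ?_⟩
    have h1 := hN (n, max N₁ N₂) ⟨(le_max_left _ _).trans hn, le_max_right _ _⟩
    have h2 := (hpos (f n - f (max N₁ N₂))).trans_lt h1
    rw [dist_eq_norm]
    exact lt_of_pow_lt_pow_left₀ 2 hδ.le (lt_of_mul_lt_mul_left h2 hε.le)
  obtain ⟨g, hg⟩ := cauchySeq_tendsto_of_complete hcau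
  have hre : ∀ x : S.domain, (⟪h, (x : H)⟫_ℂ).re = (⟪g, S x⟫_ℂ).re := fun x => by
    have hlim : Tendsto (fun n => (⟪(f n : H), S x⟫_ℂ).re) atTop (𝓝 (⟪g, S x⟫_ℂ).re) :=
      (Complex.continuous_re.tendsto _).comp (hg.inner tendsto_const_nhds)
    -- The limit `g` may lie outside `D(S)`, so the variation is taken along the minimising
    -- sequence. A nonnegative quadratic in `t` without constant term has zero linear coefficient.
    have hmin : ∀ t : ℝ, 0 ≤ 2 * t * ((⟪g, S x⟫_ℂ).re - (⟪h, (x : H)⟫_ℂ).re) +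
        t ^ 2 * quadForm S x := fun t => by
      have h1 : Tendsto (fun n => energy S h (f n + (t : ℂ) • x)) atTop
          (𝓝 (d + 2 * t * ((⟪g, S x⟫_ℂ).re - (⟪h, (x : H)⟫_ℂ).re) + t ^ 2 * quadForm S x)) := by
        simp only [hS.energy_add_smul]
        exact (hE.add ((hlim.sub_const _).const_mul _)).add_const _
      have h2 := ge_of_tendsto' h1 fun n => hd_le _
      linarith
    have hdisc := discrim_le_zero (a := quadForm S x)
      (b := 2 * ((⟪g, S x⟫_ℂ).re - (⟪h, (x : H)⟫_ℂ).re)) (c := 0) fun t => by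
        have := hmin t
        linarith [sq t]
    have h0 : (2 * ((⟪g, S x⟫_ℂ).re - (⟪h, (x : H)⟫_ℂ).re)) ^ 2 = 0 := by
      refine le_antisymm ?_ (sq_nonneg _)
      simpa [discrim] using hdisc
    linarith [pow_eq_zero_iff two_ne_zero |>.1 h0]
  refine ⟨g, ⟨f, hg, ?_⟩, fun x => Complex.ext (hre x) ?_⟩
  · have h1 : Tendsto (fun p : ℕ × ℕ => ((quadForm S (f p.1 - f p.2) : ℝ) : ℂ)) atTop
        (𝓝 ((0 : ℝ) : ℂ)) := (Complex.continuous_ofReal.tendsto _).comp hqE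
    refine h1.congr fun p => ?_
    exact (hS.isNonnegSymmetric.inner_eq_re _).symm
  -- Replacing `x` by `i x` turns the identity of real parts into that of imaginary parts.
  · simpa [LinearPMap.map_smul, inner_smul_right] using hre (Complex.I • x)

end IsStrictlyPosSymmetric

/-! ### Adjoint, Friedrichs extension and `K`-invariance through graphs. -/

section Graphs

variable [CompleteSpace H] {S T : H →ₗ.[ℂ] H} {K : H ≃L[ℂ] H}

theorem mem_adjoint_graph_iff (hd : Dense (S.domain : Set H)) {y w : H} :
    (y, w) ∈ (S†).graph ↔ ∀ x : S.domain, ⟪w, (x : H)⟫_ℂ = ⟪y, S x⟫_ℂ := by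
  rw [LinearPMap.mem_graph_iff]
  constructor
  · rintro ⟨z, hz, hw⟩ x
    simp only at hz hw
    rw [← hw, ← hz]
    exact LinearPMap.adjoint_isFormalAdjoint hd z x
  · intro h
    exact ⟨⟨y, LinearPMap.mem_adjoint_domain_of_exists y ⟨w, h⟩⟩, rfl,
      LinearPMap.adjoint_apply_eq hd _ h⟩

theorem mem_conjugate_graph_iff {x y : H} :
    (x, y) ∈ (conjugate K T).graph ↔
      ∃ z, (K x, z) ∈ T.graph ∧ ContinuousLinearMap.adjoint (K : H →L[ℂ] H) z = y := by
  simp only [mem_graph_iff_exists_mem]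
  constructor
  · rintro ⟨hx, rfl⟩
    exact ⟨_, ⟨hx, rfl⟩, rfl⟩
  · rintro ⟨_, ⟨hx, rfl⟩, rfl⟩
    exact ⟨hx, rfl⟩

theorem adjoint_adjoint_symm_apply (K : H ≃L[ℂ] H) (y : H) :
    ContinuousLinearMap.adjoint (K : H →L[ℂ] H)
      (ContinuousLinearMap.adjoint (K.symm : H →L[ℂ] H) y) = y :=
  ext_inner_right ℂ fun v => by simp [ContinuousLinearMap.adjoint_inner_left]

theorem adjoint_symm_adjoint_apply (K : H ≃L[ℂ] H) (y : H) :
    ContinuousLinearMap.adjoint (K.symm : H →L[ℂ] H)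
      (ContinuousLinearMap.adjoint (K : H →L[ℂ] H) y) = y :=
  ext_inner_right ℂ fun v => by simp [ContinuousLinearMap.adjoint_inner_left]

/-- Invariance under `K`, read off from the graph. -/
theorem conjugate_eq_iff : conjugate K T = T ↔ ∀ x z, (K x, z) ∈ T.graph ↔
    (x, ContinuousLinearMap.adjoint (K : H →L[ℂ] H) z) ∈ T.graph := by
  constructor
  · intro h x z
    conv_rhs => rw [← h, mem_conjugate_graph_iff]
    constructor
    · exact fun hz => ⟨z, hz, rfl⟩
    · rintro ⟨w, hw, hwz⟩
      rwa [← adjoint_symm_adjoint_apply K z, ← hwz, adjoint_symm_adjoint_apply]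
  · intro h
    refine LinearPMap.eq_of_eq_graph (Submodule.ext ?_)
    rintro ⟨x, y⟩
    rw [mem_conjugate_graph_iff]
    constructor
    · rintro ⟨z, hz, rfl⟩
      exact (h x z).1 hz
    · intro hy
      refine ⟨ContinuousLinearMap.adjoint (K.symm : H →L[ℂ] H) y, (h x _).2 ?_,
        adjoint_adjoint_symm_apply K y⟩
      rwa [adjoint_adjoint_symm_apply]

theorem IsKInvariant.mem_domain_iff (h : IsKInvariant K T) {x : H} :
    K x ∈ T.domain ↔ x ∈ T.domain := by
  conv_rhs => rw [← h.conjugate_eq]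
  rfl

theorem IsKInvariant.adjoint_apply (h : IsKInvariant K T) (x : T.domain) :
    ContinuousLinearMap.adjoint (K : H →L[ℂ] H) (T ⟨K x, h.mem_domain_iff.2 x.2⟩) = T x := by
  have h1 := (conjugate_eq_iff.1 h.conjugate_eq x _).1
    (T.mem_graph ⟨K x, h.mem_domain_iff.2 x.2⟩)
  exact T.mem_graph_snd_inj h1 (T.mem_graph x) rfl

/-- The adjoint of a `K`-invariant operator is `K`-invariant. -/
theorem IsKInvariant.mem_adjoint_graph_iff (h : IsKInvariant K S) {x z : H} :
    (K x, z) ∈ (S†).graph ↔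
      (x, ContinuousLinearMap.adjoint (K : H →L[ℂ] H) z) ∈ (S†).graph := by
  rw [KInvariant.mem_adjoint_graph_iff h.dense, KInvariant.mem_adjoint_graph_iff h.dense]
  have key : ∀ y : S.domain,
      (⟪ContinuousLinearMap.adjoint (K : H →L[ℂ] H) z, (y : H)⟫_ℂ = ⟪x, S y⟫_ℂ ↔
        ⟪z, K y⟫_ℂ = ⟪K x, S ⟨K y, h.mem_domain_iff.2 y.2⟩⟫_ℂ) := fun y => by
    rw [ContinuousLinearMap.adjoint_inner_left, ← h.adjoint_apply y,
      ContinuousLinearMap.adjoint_inner_right]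
    rfl
  constructor
  · exact fun hz y => (key y).2 (hz ⟨K y, h.mem_domain_iff.2 y.2⟩)
  · intro hz y
    have hy : K.symm y ∈ S.domain := h.mem_domain_iff.1 (by simp)
    simpa using (key ⟨K.symm y, hy⟩).1 (hz _)

/-- `K` is isometric for the form of `S`, so it carries form-Cauchy sequences to form-Cauchy
sequences. -/
theorem inner_map_apply (h : IsKInvariant K S) (x : S.domain) :
    ⟪K x, S ⟨K x, h.mem_domain_iff.2 x.2⟩⟫_ℂ = ⟪(x : H), S x⟫_ℂ := by
  conv_rhs => rw [← h.adjoint_apply x, ContinuousLinearMap.adjoint_inner_right]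
  rfl

theorem InFormDomain.map (h : IsKInvariant K S) {g : H} (hg : InFormDomain S g) :
    InFormDomain S (K g) := by
  obtain ⟨f, hf, hq⟩ := hg
  refine ⟨fun n => ⟨K (f n), h.mem_domain_iff.2 (f n).2⟩, (K.continuous.tendsto g).comp hf,
    hq.congr fun p => ?_⟩
  rw [← inner_map_apply h]
  have : (⟨K (f p.1), h.mem_domain_iff.2 (f p.1).2⟩ - ⟨K (f p.2), h.mem_domain_iff.2 (f p.2).2⟩ :
      S.domain) = ⟨K ((f p.1 - f p.2 : S.domain) : H), h.mem_domain_iff.2 (f p.1 - f p.2).2⟩ :=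
    Subtype.ext (by simp)
  simp only [this]

/-- Lets every one-sided inclusion proved for `K` be reversed. -/
theorem IsKInvariant.symm (h : IsKInvariant K S) : IsKInvariant K.symm S where
  dense := h.dense
  closable := h.closable
  conjugate_eq := conjugate_eq_iff.2 fun x z => by
    have h1 := conjugate_eq_iff.1 h.conjugate_eq (K.symm x)
      (ContinuousLinearMap.adjoint (K.symm : H →L[ℂ] H) z)
    rw [adjoint_adjoint_symm_apply, K.apply_symm_apply] at h1
    exact h1.symm

theorem IsKInvariant.inFormDomain_iff (h : IsKInvariant K S) {g : H} :
    InFormDomain S (K g) ↔ InFormDomain S g :=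
  ⟨fun hg => by simpa using hg.map h.symm, fun hg => hg.map h⟩

theorem mem_friedrichs_graph_iff (hS : IsNonnegSymmetric S) {x y : H} :
    (x, y) ∈ (friedrichs S hS).graph ↔ (x, y) ∈ (S†).graph ∧ InFormDomain S x := by
  simp only [mem_graph_iff_exists_mem]
  constructor
  · rintro ⟨hx, rfl⟩
    exact ⟨⟨hx.1, rfl⟩, hx.2⟩
  · rintro ⟨⟨hx, rfl⟩, hx'⟩
    exact ⟨⟨hx, hx'⟩, rfl⟩

/-- The Friedrichs extension of a `K`-invariant operator is `K`-invariant. -/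
theorem IsKInvariant.mem_friedrichs_graph_iff (hS : IsNonnegSymmetric S) (h : IsKInvariant K S)
    {x z : H} : (K x, z) ∈ (friedrichs S hS).graph ↔
      (x, ContinuousLinearMap.adjoint (K : H →L[ℂ] H) z) ∈ (friedrichs S hS).graph := by
  rw [KInvariant.mem_friedrichs_graph_iff, KInvariant.mem_friedrichs_graph_iff,
    h.mem_adjoint_graph_iff, h.inFormDomain_iff]

theorem mem_kerAdjoint_iff {x : H} : x ∈ kerAdjoint S ↔ (x, (0 : H)) ∈ (S†).graph := by
  rw [mem_graph_iff_exists_mem, kerAdjoint, Submodule.mem_map]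
  constructor
  · rintro ⟨y, hy, rfl⟩
    exact ⟨y.2, hy⟩
  · rintro ⟨hx, hx0⟩
    exact ⟨⟨x, hx⟩, hx0, rfl⟩

theorem mem_kerAdjoint_iff_inner (hd : Dense (S.domain : Set H)) {x : H} :
    x ∈ kerAdjoint S ↔ ∀ y : S.domain, ⟪x, S y⟫_ℂ = 0 := by
  rw [mem_kerAdjoint_iff, mem_adjoint_graph_iff hd]
  simp only [inner_zero_left, eq_comm]

theorem kerAdjoint_eq_orthogonal (hd : Dense (S.domain : Set H)) :
    kerAdjoint S = (LinearMap.range S.toFun)ᗮ := by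
  ext x
  rw [mem_kerAdjoint_iff_inner hd, Submodule.mem_orthogonal']
  constructor
  · rintro h _ ⟨y, rfl⟩
    exact h y
  · exact fun h y => h _ ⟨y, rfl⟩

theorem IsNonnegSymmetric.le_adjoint (hS : IsNonnegSymmetric S) : S ≤ S† :=
  LinearPMap.IsFormalAdjoint.le_adjoint hS.dense hS.symm

theorem IsNonnegSymmetric.le_friedrichs (hS : IsNonnegSymmetric S) : S ≤ friedrichs S hS := by
  refine LinearPMap.le_of_le_graph ?_
  rintro ⟨x, y⟩ hxy
  refine (mem_friedrichs_graph_iff hS).2 ⟨LinearPMap.le_graph_of_le hS.le_adjoint hxy, ?_⟩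
  obtain ⟨z, hz, -⟩ := (LinearPMap.mem_graph_iff S).1 hxy
  obtain rfl : (z : H) = x := hz
  exact ⟨fun _ => z, tendsto_const_nhds, by simp⟩

theorem mem_extension_graph_iff (hS : IsNonnegSymmetric S) {M : Submodule ℂ H} {x y : H} :
    (x, y) ∈ (extension S hS M).graph ↔ (x, y) ∈ (S†).graph ∧ x ∈ extensionDomain S hS M := by
  simp only [mem_graph_iff_exists_mem]
  constructor
  · rintro ⟨hx, rfl⟩
    exact ⟨⟨hx.2, rfl⟩, hx.1⟩
  · rintro ⟨⟨hx, rfl⟩, hx'⟩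
    exact ⟨⟨hx', hx⟩, rfl⟩

end Graphs

/-! ### Inverse of `S_F`, and the domain and invariance of `S_M`. -/

namespace IsStrictlyPosSymmetric

variable [CompleteSpace H] {S : H →ₗ.[ℂ] H} {K : H ≃L[ℂ] H} {M : Submodule ℂ H}

theorem ker_friedrichs (hS : IsStrictlyPosSymmetric S) :
    LinearMap.ker (friedrichs S hS.isNonnegSymmetric).toFun = ⊥ := by
  refine (LinearMap.ker_eq_bot').2 fun x hx => Subtype.ext ?_
  have h1 := (friedrichs S hS.isNonnegSymmetric).mem_graph x
  rw [show friedrichs S hS.isNonnegSymmetric x = 0 from hx, mem_friedrichs_graph_iff,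
    mem_adjoint_graph_iff hS.dense] at h1
  exact hS.eq_zero_of_inFormDomain h1.2 fun y => by simpa using (h1.1 y).symm

theorem exists_mem_friedrichs_graph (hS : IsStrictlyPosSymmetric S) (h : H) :
    ∃ g, (g, h) ∈ (friedrichs S hS.isNonnegSymmetric).graph := by
  obtain ⟨g, hg, hgx⟩ := hS.exists_inFormDomain_forall_inner_eq h
  exact ⟨g, (mem_friedrichs_graph_iff _).2 ⟨(mem_adjoint_graph_iff hS.dense).2 hgx, hg⟩⟩

theorem inverse_friedrichs_domain (hS : IsStrictlyPosSymmetric S) :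
    (friedrichs S hS.isNonnegSymmetric).inverse.domain = ⊤ := by
  rw [LinearPMap.inverse_domain, eq_top_iff]
  intro h _
  obtain ⟨g, hg⟩ := hS.exists_mem_friedrichs_graph h
  obtain ⟨y, -, hy⟩ := (LinearPMap.mem_graph_iff _).1 hg
  exact ⟨y, hy⟩

theorem mem_inverse_friedrichs_graph_iff (hS : IsStrictlyPosSymmetric S) {x y : H} :
    (y, x) ∈ (friedrichs S hS.isNonnegSymmetric).inverse.graph ↔
      (x, y) ∈ (friedrichs S hS.isNonnegSymmetric).graph := by
  rw [LinearPMap.inverse_graph hS.ker_friedrichs]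
  simp

theorem mem_friedrichsPart_iff (hS : IsStrictlyPosSymmetric S) {x : H} :
    x ∈ friedrichsPart S hS.isNonnegSymmetric M ↔ ∃ η ∈ Mᗮ ⊓ kerAdjoint S,
      (x, η) ∈ (friedrichs S hS.isNonnegSymmetric).graph := by
  simp only [← hS.mem_inverse_friedrichs_graph_iff, mem_graph_iff_exists_mem, friedrichsPart,
    inverseImage, Submodule.mem_map]
  constructor
  · rintro ⟨y, hy, rfl⟩
    exact ⟨y, hy, y.2, rfl⟩
  · rintro ⟨η, hη, hd, rfl⟩
    exact ⟨⟨η, hd⟩, hη, rfl⟩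

theorem friedrichsPart_le (hS : IsStrictlyPosSymmetric S) :
    friedrichsPart S hS.isNonnegSymmetric M ≤ (S†).domain := by
  intro x hx
  obtain ⟨η, -, h⟩ := hS.mem_friedrichsPart_iff.1 hx
  exact LinearPMap.mem_domain_of_mem_graph ((mem_friedrichs_graph_iff _).1 h).1

theorem kerAdjoint_le : kerAdjoint S ≤ (S†).domain := fun _ hx =>
  LinearPMap.mem_domain_of_mem_graph (mem_kerAdjoint_iff.1 hx)

theorem extensionDomain_le (hS : IsStrictlyPosSymmetric S) (hM : M ≤ kerAdjoint S) :
    extensionDomain S hS.isNonnegSymmetric M ≤ (S†).domain :=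
  sup_le (sup_le hS.isNonnegSymmetric.le_adjoint.1 (hM.trans kerAdjoint_le)) hS.friedrichsPart_le

/-- `D(S_M) = M + S_F⁻¹ M^⊥`. -/
theorem mem_extensionDomain_iff (hS : IsStrictlyPosSymmetric S) (hc : S.IsClosed)
    (hM : M ≤ kerAdjoint S) {x : H} :
    x ∈ extensionDomain S hS.isNonnegSymmetric M ↔ ∃ m ∈ M, ∃ g, ∃ η ∈ Mᗮ,
      (g, η) ∈ (friedrichs S hS.isNonnegSymmetric).graph ∧ m + g = x := by
  have hle := LinearPMap.le_graph_of_le hS.isNonnegSymmetric.le_friedrichs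
  have hran : ∀ f : S.domain, S f ∈ Mᗮ := fun f =>
    (Submodule.mem_orthogonal _ _).2 fun m hm =>
      (mem_kerAdjoint_iff_inner hS.dense).1 (hM hm) f
  simp only [extensionDomain, Submodule.mem_sup]
  constructor
  · rintro ⟨_, ⟨f, hf, m, hm, rfl⟩, g, hg, rfl⟩
    obtain ⟨η, hη, h⟩ := hS.mem_friedrichsPart_iff.1 hg
    refine ⟨m, hm, f + g, S ⟨f, hf⟩ + η, Submodule.add_mem _ (hran _) hη.1,
      Submodule.add_mem _ (hle (S.mem_graph ⟨f, hf⟩)) h, by abel⟩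
  · rintro ⟨m, hm, g, η, hη, h, rfl⟩
    -- Split `η = S f + η'` with `η' ∈ ker S*`. Then `S_F (g - f) = η'`, and `η' = η - S f` is still
    -- in `Mᗮ`.
    have : CompleteSpace (LinearMap.range S.toFun) :=
      (hS.isClosed_range hc).completeSpace_coe
    obtain ⟨_, ⟨f, rfl⟩, η', hη', rfl⟩ :=
      (LinearMap.range S.toFun).exists_add_mem_mem_orthogonal (v := η)
    rw [← kerAdjoint_eq_orthogonal hS.dense] at hη'
    refine ⟨f + m, ⟨f, f.2, m, hm, rfl⟩, g - f, hS.mem_friedrichsPart_iff.2 ⟨η', ⟨?_, hη'⟩, ?_⟩,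
      by abel⟩
    · simpa using Submodule.sub_mem _ hη (hran f)
    · simpa using Submodule.sub_mem _ h (hle (S.mem_graph f))

/-- Applying `S*` gives `S f + η = 0` with `η ∈ ker S*` orthogonal to `S f`, so both vanish; `S` and
`S_F` are injective. -/
theorem eq_zero_of_add_eq_zero (hS : IsStrictlyPosSymmetric S) (hM : M ≤ kerAdjoint S)
    {f m g : H} (hf : f ∈ S.domain) (hm : m ∈ M)
    (hg : g ∈ friedrichsPart S hS.isNonnegSymmetric M) (h : f + m + g = 0) :
    f = 0 ∧ m = 0 ∧ g = 0 := by
  obtain ⟨η, hη, hgη⟩ := hS.mem_friedrichsPart_iff.1 hg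
  have hle := LinearPMap.le_graph_of_le hS.isNonnegSymmetric.le_adjoint
  have h1 : (f + m + g, S ⟨f, hf⟩ + 0 + η) ∈ (S†).graph :=
    Submodule.add_mem _ (Submodule.add_mem _ (hle (S.mem_graph ⟨f, hf⟩))
      (mem_kerAdjoint_iff.1 (hM hm))) ((mem_friedrichs_graph_iff _).1 hgη).1
  have h2 : S ⟨f, hf⟩ + η = 0 := by
    simpa using LinearPMap.graph_fst_eq_zero_snd _ h1 h
  have h3 : η = 0 := by
    have h4 := (mem_kerAdjoint_iff_inner hS.dense).1 hη.2 ⟨f, hf⟩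
    rw [eq_neg_of_add_eq_zero_left h2, inner_neg_right, neg_eq_zero] at h4
    exact inner_self_eq_zero.1 h4
  have hg0 : g = 0 := by
    rw [h3] at hgη
    obtain ⟨y, hy, hy0⟩ := (LinearPMap.mem_graph_iff _).1 hgη
    rw [← show (y : H) = g from hy,
      show y = 0 from LinearMap.ker_eq_bot'.1 hS.ker_friedrichs y hy0]
    rfl
  have hf0 : f = 0 := by
    obtain ⟨ε, hε, hb⟩ := hS.mul_norm_le
    have h5 := hb ⟨f, hf⟩
    rw [h3, add_zero] at h2
    rw [h2, norm_zero] at h5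
    exact norm_le_zero_iff.1 (nonpos_of_mul_nonpos_right h5 hε)
  refine ⟨hf0, ?_, hg0⟩
  simpa [hf0, hg0] using h

theorem iSupIndep_summands (hS : IsStrictlyPosSymmetric S) (hM : M ≤ kerAdjoint S) :
    iSupIndep ![S.domain, M, friedrichsPart S hS.isNonnegSymmetric M] := by
  refine iSupIndep_fin_three.2 ⟨?_, ?_, ?_⟩ <;>
    refine Submodule.disjoint_def.2 fun x hx hx' => ?_ <;>
    obtain ⟨a, ha, b, hb, rfl⟩ := Submodule.mem_sup.1 hx'
  · have := hS.eq_zero_of_add_eq_zero hM (neg_mem hx) ha hb (by abel)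
    exact neg_eq_zero.1 this.1
  · have := hS.eq_zero_of_add_eq_zero hM hb (neg_mem hx) ha (by abel)
    exact neg_eq_zero.1 this.2.1
  · have := hS.eq_zero_of_add_eq_zero hM ha hb (neg_mem hx) (by abel)
    exact neg_eq_zero.1 this.2.2

theorem extension_domain (hS : IsStrictlyPosSymmetric S) (hM : M ≤ kerAdjoint S) :
    (extension S hS.isNonnegSymmetric M).domain = extensionDomain S hS.isNonnegSymmetric M :=
  inf_eq_left.2 (hS.extensionDomain_le hM)

theorem le_extension (hS : IsStrictlyPosSymmetric S) :
    S ≤ extension S hS.isNonnegSymmetric M := by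
  refine LinearPMap.le_of_le_graph ?_
  rintro ⟨x, y⟩ hxy
  refine (mem_extension_graph_iff _).2
    ⟨LinearPMap.le_graph_of_le hS.isNonnegSymmetric.le_adjoint hxy, ?_⟩
  exact Submodule.mem_sup_left (Submodule.mem_sup_left (LinearPMap.mem_domain_of_mem_graph hxy))

theorem map_mem_extensionDomain (hS : IsStrictlyPosSymmetric S) (hc : S.IsClosed)
    (hinv : IsKInvariant K S) (hM : M ≤ kerAdjoint S) (hK : ∀ m, K m ∈ M ↔ m ∈ M) {x : H}
    (hx : x ∈ extensionDomain S hS.isNonnegSymmetric M) :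
    K x ∈ extensionDomain S hS.isNonnegSymmetric M := by
  rw [hS.mem_extensionDomain_iff hc hM] at hx ⊢
  obtain ⟨m, hm, g, η, hη, h, rfl⟩ := hx
  -- `K* S_F K = S_F` forces `S_F (K g) = (K⁻¹)* η`.
  refine ⟨K m, (hK m).2 hm, K g, ContinuousLinearMap.adjoint (K.symm : H →L[ℂ] H) η, ?_,
    (hinv.mem_friedrichs_graph_iff _).2 ?_, (map_add K m g).symm⟩
  · refine (Submodule.mem_orthogonal' _ _).2 fun u hu => ?_
    rw [ContinuousLinearMap.adjoint_inner_left]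
    exact (Submodule.mem_orthogonal' _ _).1 hη _ ((hK _).1 (by simpa using hu))
  · rwa [adjoint_adjoint_symm_apply]

/-- The extension `S_M` is `K`-invariant if `M` is. -/
theorem isKInvariant_extension (hS : IsStrictlyPosSymmetric S) (hc : S.IsClosed)
    (hinv : IsKInvariant K S) (hM : M ≤ kerAdjoint S) (hK : ∀ m, K m ∈ M ↔ m ∈ M) :
    IsKInvariant K (extension S hS.isNonnegSymmetric M) where
  dense := hS.dense.mono hS.le_extension.1
  closable := (LinearPMap.adjoint_isClosed hS.dense).isClosable.leIsClosable
    LinearPMap.domRestrict_le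
  conjugate_eq := conjugate_eq_iff.2 fun x z => by
    rw [mem_extension_graph_iff, mem_extension_graph_iff, hinv.mem_adjoint_graph_iff]
    refine and_congr_right fun _ => ⟨fun hx => ?_, hS.map_mem_extensionDomain hc hinv hM hK⟩
    have hK' : ∀ m, K.symm m ∈ M ↔ m ∈ M := fun m => by rw [← hK, K.apply_symm_apply]
    simpa using hS.map_mem_extensionDomain hc hinv.symm hM hK' hx

end IsStrictlyPosSymmetric

end KInvariant

theorem mainTheorem8 {H : Type*} [NormedAddCommGroup H] [InnerProductSpace ℂ H] [CompleteSpace H]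
    (K : H ≃L[ℂ] H) (S : H →ₗ.[ℂ] H)
    (hS : KInvariant.IsStrictlyPosSymmetric S) (hclosed : S.IsClosed)
    (hinv : KInvariant.IsKInvariant K S)
    (M : Submodule ℂ H) (hMclosed : IsClosed (M : Set H))
    (hMker : M ≤ KInvariant.kerAdjoint S)
    (hKM : M.map (K.symm : H →ₗ[ℂ] H) = M) :
    -- `S_F` is a bijection from its domain onto `H`, so that `S_F⁻¹` is defined on all of `H`
    LinearMap.ker (KInvariant.friedrichs S hS.isNonnegSymmetric).toFun = ⊥ ∧
    (KInvariant.friedrichs S hS.isNonnegSymmetric).inverse.domain = ⊤ ∧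
    -- the sum defining the domain of `S_M` is direct
    iSupIndep ![S.domain, M, KInvariant.friedrichsPart S hS.isNonnegSymmetric M] ∧
    -- `S_M` has that sum as its domain and extends `S`
    (KInvariant.extension S hS.isNonnegSymmetric M).domain =
      KInvariant.extensionDomain S hS.isNonnegSymmetric M ∧
    S ≤ KInvariant.extension S hS.isNonnegSymmetric M ∧
    -- `S_M` is `K`-invariant
    KInvariant.IsKInvariant K (KInvariant.extension S hS.isNonnegSymmetric M) := by
  have hK : ∀ m, K m ∈ M ↔ m ∈ M := fun m => by
    constructor
    · intro h
      rw [← hKM]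
      exact ⟨K m, h, by simp⟩
    · intro h
      rw [← hKM] at h
      obtain ⟨u, hu, rfl⟩ := h
      simpa using hu
  exact ⟨hS.ker_friedrichs, hS.inverse_friedrichs_domain, hS.iSupIndep_summands hMker,
    hS.extension_domain hMker, hS.le_extension, hS.isKInvariant_extension hclosed hinv hMker hK⟩
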